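/- **Setting.** Let $\Sigma$ be a finite alphabet. A hard-attention transformer reads a word $w\in\Sigma^*$ followed by an end-of-sequence symbol, i.e. $x=x_1\dots x_m$ with $m=|w|+1$ and $x_m$ the end-of-sequence symbol. It has a fixed number $L$ of layers, a fixed number $H$ of attention heads per layer, an embedding $x\mapsto v(x)$ of the symbols, positional embeddings $p_1,p_2,\dots$ (independent of the input), and a map $f$; the layer-0 activations are $y_i^{(0)}=f(v(x_i),p_i)$. For $k=1,\dots,L$ and $h=1,\dots,H$, with arbitrary real-valued functions $f^{att}_{k,h}$, head $h$ of layer $k$ at position $i$ attends to the position $j^*$ that maximizes $f^{att}_{k,h}(y_i^{(k-1)},y_j^{(k-1)})$ over $1\le j\le m$ (the first one in case of ties), and $b_{i,k,h}=y_{j^*}^{(k-1)}$. The activations of layer $k$ are $y_i^{(k)}=f^{act}_k(y_i^{(k-1)},b_{i,k,1},\dots,b_{i,k,H})$ with an arbitrary function $f^{act}_k$. Embeddings and activations may take values in arbitrary sets. A softmax probability vector for the two labels $1$ ("in the language") and $0$ ("not in the language") is computed from the last activation $y_m^{(L)}$, through arbitrary real logits; the word is accepted if label $1$ is the more probable one.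 The number of layers and heads and all the functions do not depend on the length of the input. The transformer *recognizes a language at length $n$* if it accepts exactly those words of length $n$ that are in the language. PARITY is the set of bit strings with an even number of $1$s. For $k\ge 1$, $k$DYCK is the language of correctly bracketed words over $k$ types of brackets. **Statement.** Hard-attention transformers cannot recognize PARITY, 2DYCK, or even 1DYCK, on all sufficiently long inputs. More precisely: 1. For every hard-attention transformer over the alphabet $\{0,1\}$ there is an $N$ such that for no $n\ge N$ does it recognize PARITY at length $n$. 2. For every hard-attention transformer over the alphabet of two types of brackets there is an $N$ such that for no even $n\ge N$ does it recognize 2DYCK at length $n$. 3. For every hard-attention transformer over the alphabet of one type of brackets there is an $N$ such that for no even $n\ge N$ does it recognize 1DYCK at length $n$. -/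

import Mathlib

/-- The first (leftmost) position at which `s` attains its maximum. -/
noncomputable def firstArgmax {n : ℕ} (s : Fin (n + 1) → ℝ) : Fin (n + 1) := by
  classical
  exact (Finset.univ.filter fun j => ∀ j', s j' ≤ s j).min' <| by
    obtain ⟨j, hj⟩ := Finite.exists_max s
    exact ⟨j, by simpa using hj⟩

/-- A hard-attention transformer reading words over the alphabet `S`, followed by an
end-of-sequence symbol. The input alphabet is `Option S`, where `none` is the end-of-sequence
symbol. Symbol embeddings, positional embeddings and activations take values in arbitrary
types `E`, `P`, `A`, for instance spaces `ℝ^k`, and all the maps are arbitrary functions. -/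
structure HardAttentionTransformer (S E P A : Type*) where
  /-- the number of layers -/
  numLayers : ℕ
  /-- the number of attention heads of each layer -/
  numHeads : ℕ
  /-- the embedding of the input symbols -/
  embed : Option S → E
  /-- the positional embeddings `p₁, p₂, …`, independent of the input -/
  pos : ℕ → P
  /-- the map combining a symbol embedding and a positional embedding -/
  combine : E → P → A
  /-- the attention score of each layer and head, as a function of the activations of the
  attending and the attended position -/
  att : Fin numLayers → Fin numHeads → A → A → ℝ
  /-- the activation map of each layer, applied to the activation of a position in the previous
  layer and to the activations of the attention heads at this position -/
  act : Fin numLayers → A → (Fin numHeads → A) → A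
  /-- the logits of the labels `true` ("in the language") and `false` ("not in the language"),
  as a function of the last activation -/
  logit : A → Bool → ℝ

namespace HardAttentionTransformer

variable {S E P A : Type*} (T : HardAttentionTransformer S E P A)

/-- The activation of head `h` of layer `k` at position `i`, given the activations `y` of the
previous layer. As the attention weights are `1` at the first position of maximal attention score
and `0` elsewhere, the weighted sum of the activations is the activation at that position. -/
noncomputable def head {n : ℕ} (k : Fin T.numLayers) (y : Fin (n + 1) → A) (i : Fin (n + 1))
    (h : Fin T.numHeads) : A :=
  y (firstArgmax fun j => T.att k h (y i) (y j))

/-- The activations of all positions after each layer, on the input `x`.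
Layer `0` consists of the combined symbol and positional embeddings. -/
noncomputable def activation {n : ℕ} (x : Fin (n + 1) → Option S) :
    Fin (T.numLayers + 1) → Fin (n + 1) → A :=
  Fin.induction (motive := fun _ => Fin (n + 1) → A)
    (fun i => T.combine (T.embed (x i)) (T.pos (i + 1)))
    (fun k y i => T.act k (y i) (T.head k y i))

/-- The input sequence for the word `w`: its letters followed by the end-of-sequence symbol. -/
def inputOf (w : List S) : Fin (w.length + 1) → Option S := fun i => w[(i : ℕ)]?

/-- The activation of the last position (end of sequence) after the last layer. -/
noncomputable def finalActivation (w : List S) : A :=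
  T.activation (inputOf w) (Fin.last T.numLayers) (Fin.last w.length)

/-- The softmax probability that the transformer assigns to the label `b` on the word `w`. -/
noncomputable def labelProb (w : List S) (b : Bool) : ℝ :=
  Real.exp (T.logit (T.finalActivation w) b) /
    ∑ b' : Bool, Real.exp (T.logit (T.finalActivation w) b')

/-- The transformer accepts `w` if the label "in the language" is the more probable one. -/
def Accepts (w : List S) : Prop := T.labelProb w false < T.labelProb w true

/-- The transformer classifies all words of length `n` correctly as belonging or not
belonging to the language. -/
def RecognizesAtLength (lang : Language S) (n : ℕ) : Prop :=
  ∀ w : List S, w.length = n → (T.Accepts w ↔ w ∈ lang)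

end HardAttentionTransformer

/-- The bit strings with an even number of ones. -/
def parityLang : Language Bool := {w | Even (w.count true)}

/-- The brackets of types `κ`. -/
inductive BracketSymbol (κ : Type*) where
  | opening (c : κ)
  | closing (c : κ)

/-- The correctly bracketed words: those generated by `S → ε` and `S → (S)S` for each bracket
type. -/
inductive WellBracketed {κ : Type*} : List (BracketSymbol κ) → Prop
  | nil : WellBracketed []
  | wrap (c : κ) (u v : List (BracketSymbol κ)) : WellBracketed u → WellBracketed v →
      WellBracketed (BracketSymbol.opening c :: (u ++ BracketSymbol.closing c :: v))

/-- The language of correctly bracketed words over `k` types of brackets. -/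
def dyckLang (k : ℕ) : Language (BracketSymbol (Fin k)) := {w | WellBracketed w}

/-! The proof uses random restrictions: each input bit stays free with probability `1/(q+1)` and is
otherwise fixed to a random value. Suppose all activations of a layer are decision trees of bounded
depth. Once the activation at the attending position is fixed, a head of the next layer is a
decision list of bounded width, with terms sorted by decreasing attention score
(`exists_decisionList_attention`). A switching lemma whose bound does not involve the length of the
list (`DecisionList.failProb_le`) makes the restricted head a shallow tree again, except with small
probability. A union bound over positions, heads and the boundedly many attending values settles a
layer (`exists_restriction_layer`).

After all layers, the value of the last activation at any given input is certified by boundedly many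
bits, while more bits than that are still free. Flipping a free bit outside the certificate goes
unnoticed (`exists_flip_activation_eq`), which refutes PARITY. For Dyck languages the word before
the flip must lie in the language, so the restriction must also leave a balanced bit string
reachable. Balanced strings have probability at least `1/(2N+1)`, only polynomially small, and the
parameters keep all error terms below that. A balanced string over one bracket type, placed between
enough opening and closing brackets, is well bracketed; a flip destroys this. -/

/-- `DecisionTree s f`: the function `f` of Boolean variables is computed by a decision tree of
depth at most `s`. -/
inductive DecisionTree {ι B : Type*} [DecidableEq ι] : ℕ → ((ι → Bool) → B) → Prop
  | const (s : ℕ) (f : (ι → Bool) → B) (h : ∀ x y, f x = f y) : DecisionTree s f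
  | query (s : ℕ) (f : (ι → Bool) → B) (v : ι)
      (h : ∀ b, DecisionTree s fun x => f (Function.update x v b)) : DecisionTree (s + 1) f

/-- The function with the value `b` where the term fixing the variables in `V` to their values in
`a` is satisfied, and with the value of `f` elsewhere. -/
def prependTerm {ι B : Type*} (V : Finset ι) (a : ι → Bool) (b : B) (f : (ι → Bool) → B) :
    (ι → Bool) → B := fun x => if ∀ v ∈ V, x v = a v then b else f x

/-- `DecisionList c n f`: the function `f` of Boolean variables is computed by a decision list with
at most `n` terms, each of which fixes the values of at most `c` variables. -/
inductive DecisionList {ι B : Type*} (c : ℕ) : ℕ → ((ι → Bool) → B) → Prop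
  | const (n : ℕ) (b : B) : DecisionList c n fun _ => b
  | cons (n : ℕ) (V : Finset ι) (a : ι → Bool) (b : B) (f : (ι → Bool) → B) (hV : V.card ≤ c)
      (h : DecisionList c n f) :
      DecisionList c (n + 1) (prependTerm V a b f)

theorem DecisionList.mono {ι B : Type*} {c n m : ℕ} {f : (ι → Bool) → B} (h : DecisionList c n f)
    (hnm : n ≤ m) : DecisionList c m f := by
  induction h generalizing m with
  | const n b => exact .const _ _
  | cons n V a b f hV h ih =>
    obtain ⟨m, rfl⟩ : ∃ m', m = m' + 1 := ⟨m - 1, by omega⟩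
    exact .cons _ _ _ _ _ hV (ih (by omega))

/-- A family of terms with values, ordered by a key, yields a decision list that returns the value
of a satisfied term of least key. -/
theorem exists_decisionList_of_keys {ι B : Type*} {c : ℕ} {κ P : Type*} [LinearOrder κ] [DecidableEq P]
    [Inhabited B]
    (key : P → κ) (V : P → Finset ι) (a : P → ι → Bool) (val : P → B) (hV : ∀ p, (V p).card ≤ c)
    (F : Finset P) :
    ∃ n, ∃ f : (ι → Bool) → B, DecisionList c n f ∧
      ∀ x, (∃ p ∈ F, ∀ v ∈ V p, x v = a p v) →
        ∃ p ∈ F, (∀ v ∈ V p, x v = a p v) ∧ f x = val p ∧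
          ∀ p' ∈ F, (∀ v ∈ V p', x v = a p' v) → key p ≤ key p' := by
  -- The inserted element has a key at most all others, so its term goes to the front of the list.
  induction F using Finset.induction_on_min_value key with
  | empty => exact ⟨0, _, .const 0 default, by simp⟩
  | insert p F hp hmin ih =>
    obtain ⟨n, f, hf, h⟩ := ih
    refine ⟨n + 1, _, .cons n (V p) (a p) (val p) f (hV p) hf, fun x hx => ?_⟩
    by_cases hs : ∀ v ∈ V p, x v = a p v
    · refine ⟨p, Finset.mem_insert_self _ _, hs, if_pos hs, fun p' hp' _ => ?_⟩
      rcases Finset.mem_insert.1 hp' with rfl | hp'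
      · exact le_rfl
      · exact hmin p' hp'
    · obtain ⟨p₀, hp₀, hs₀⟩ := hx
      rcases Finset.mem_insert.1 hp₀ with rfl | hp₀
      · exact absurd hs₀ hs
      obtain ⟨p₁, hp₁, hs₁, hv, hk⟩ := h x ⟨p₀, hp₀, hs₀⟩
      refine ⟨p₁, Finset.mem_insert_of_mem hp₁, hs₁, (if_neg hs).trans hv, fun p' hp' hs' => ?_⟩
      rcases Finset.mem_insert.1 hp' with rfl | hp'
      · exact absurd hs' hs
      · exact hk p' hp' hs'

/-! ### Decision trees, decision lists and hard attention -/

section Trees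

variable {ι B C : Type*} [DecidableEq ι]

theorem DecisionTree.mono {s t : ℕ} {f : (ι → Bool) → B} (h : DecisionTree s f) (hst : s ≤ t) :
    DecisionTree t f := by
  induction h generalizing t with
  | const s f h => exact .const _ _ h
  | query s f v h ih =>
    obtain ⟨t, rfl⟩ : ∃ t', t = t' + 1 := ⟨t - 1, by omega⟩
    exact .query _ _ v fun b => ih b (by omega)

theorem DecisionTree.map {s : ℕ} {f : (ι → Bool) → B} (h : DecisionTree s f) (g : B → C) :
    DecisionTree s fun x => g (f x) := by
  induction h with
  | const s f h => exact .const _ _ fun x y => congrArg g (h x y)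
  | query s f v h ih => exact .query _ _ v ih

theorem DecisionTree.comp_update {s : ℕ} {f : (ι → Bool) → B} (h : DecisionTree s f) (w : ι)
    (d : Bool) : DecisionTree s fun x => f (Function.update x w d) := by
  induction h with
  | const s f h => exact .const _ _ fun x y => h _ _
  | query s f v h ih =>
    by_cases hvw : v = w
    · subst hvw
      exact (h d).mono (Nat.le_succ s)
    · refine .query _ _ v fun b => ?_
      convert ih b using 3 with x
      exact Function.update_comm hvw _ _ _

/-- At each leaf of the tree for `f` the value of `f` is known, and the tree of `g` for that value
is hung there. -/
theorem DecisionTree.bind {s t : ℕ} {f : (ι → Bool) → B} {g : B → (ι → Bool) → C}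
    (hf : DecisionTree s f) (hg : ∀ x, DecisionTree t (g (f x))) :
    DecisionTree (s + t) fun x => g (f x) x := by
  induction hf generalizing g with
  | const s f h =>
    have : (fun x => g (f x) x) = g (f fun _ => false) := by
      funext x
      rw [h x fun _ => false]
    rw [this]
    exact (hg _).mono (Nat.le_add_left _ _)
  | query s f v h ih =>
    rw [Nat.add_right_comm]
    refine .query _ _ v fun b => ?_
    exact ih b (g := fun a x => g a (Function.update x v b)) fun x => (hg _).comp_update v b

theorem DecisionTree.pi {s m : ℕ} {u : Fin m → (ι → Bool) → B} (h : ∀ i, DecisionTree s (u i)) :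
    DecisionTree (m * s) fun x i => u i x := by
  induction m with
  | zero => exact .const _ _ fun x y => funext fun i => i.elim0
  | succ m ih =>
    have := (h 0).bind (g := fun a x => (Fin.cons a fun i => u i.succ x : Fin (m + 1) → B))
      fun x => (ih fun i => h i.succ).map fun r => (Fin.cons (u 0 x) r : Fin (m + 1) → B)
    convert this using 1
    · ring
    · funext x i
      refine Fin.cases ?_ (fun i => ?_) i <;> simp

/-- Take the variables queried along the path that `x` follows. -/
theorem DecisionTree.exists_certificate {s : ℕ} {f : (ι → Bool) → B} (h : DecisionTree s f)
    (x : ι → Bool) : ∃ V : Finset ι, V.card ≤ s ∧ ∀ y, (∀ v ∈ V, y v = x v) → f y = f x := by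
  induction h with
  | const s f h => exact ⟨∅, by simp, fun y _ => h y x⟩
  | query s f v h ih =>
    obtain ⟨V, hV, hc⟩ := ih (x v)
    refine ⟨insert v V, (Finset.card_insert_le _ _).trans (by omega), fun y hy => ?_⟩
    have hx := hc y fun w hw => hy w (Finset.mem_insert_of_mem hw)
    have hyv : y v = x v := hy v (Finset.mem_insert_self _ _)
    simpa [← hyv] using hx.trans (by simp)

/-- A binary tree of depth `s` has at most `2 ^ s` leaves. -/
theorem DecisionTree.exists_range {s : ℕ} {f : (ι → Bool) → B} (h : DecisionTree s f) :
    ∃ R : Finset B, R.card ≤ 2 ^ s ∧ ∀ x, f x ∈ R := by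
  classical
  induction h with
  | const s f h =>
    exact ⟨{f fun _ => false}, by simpa using Nat.one_le_two_pow, fun x => by simp [h x fun _ => false]⟩
  | query s f v h ih =>
    choose R hR hf using ih
    refine ⟨R true ∪ R false, (Finset.card_union_le _ _).trans ?_, fun x => ?_⟩
    · have := hR true
      have := hR false
      rw [pow_succ]
      omega
    · have := hf (x v) x
      simp only [Function.update_eq_self] at this
      cases hx : x v <;> simp_all

theorem forall_mem_update_eq_iff (V : Finset ι) (a x : ι → Bool) (v : ι) (d : Bool) :
    (∀ w ∈ V, Function.update x v d w = a w) ↔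
      (v ∈ V → d = a v) ∧ ∀ w ∈ V.erase v, x w = a w := by
  constructor
  · intro h
    refine ⟨fun hv => by simpa using h v hv, fun w hw => ?_⟩
    rw [Finset.mem_erase] at hw
    simpa [hw.1] using h w hw.2
  · rintro ⟨h1, h2⟩ w hw
    by_cases hwv : w = v
    · subst hwv
      simpa using h1 hw
    · simpa [hwv] using h2 w (Finset.mem_erase.2 ⟨hwv, hw⟩)

theorem prependTerm_comp_update {V : Finset ι} {a : ι → Bool} (b : B) (f : (ι → Bool) → B) {v : ι}
    {d : Bool} (hv : v ∈ V → d = a v) :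
    (fun x => prependTerm V a b f (Function.update x v d)) =
      prependTerm (V.erase v) a b fun x => f (Function.update x v d) :=
  funext fun x => if_congr ((forall_mem_update_eq_iff V a x v d).trans (and_iff_right hv)) rfl rfl

/-- Fixing a variable shortens the terms that agree with it and deletes those that contradict it. -/
theorem DecisionList.comp_update {c n : ℕ} {f : (ι → Bool) → B} (h : DecisionList c n f) (v : ι)
    (d : Bool) : DecisionList c n fun x => f (Function.update x v d) := by
  induction h with
  | const n b => exact .const _ _
  | cons n V a b f hV h ih =>
    by_cases hv : v ∈ V → d = a v
    · rw [prependTerm_comp_update b f hv]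
      exact .cons n (V.erase v) a b _ ((Finset.card_erase_le).trans hV) ih
    · convert ih.mono (Nat.le_succ n) using 2 with x
      exact if_neg fun h => hv ((forall_mem_update_eq_iff V a x v d).1 h).1

theorem firstArgmax_eq {n : ℕ} {s : Fin (n + 1) → ℝ} {j : Fin (n + 1)}
    (h : ∀ j', s j' < s j ∨ s j' = s j ∧ j ≤ j') : firstArgmax s = j := by
  classical
  unfold firstArgmax
  have hj : ∀ j', s j' ≤ s j := fun j' => (h j').elim le_of_lt fun h => h.1.le
  apply le_antisymm
  · exact Finset.min'_le _ _ (by simpa using hj)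
  · apply Finset.le_min'
    intro j' hj'
    have h1 : s j ≤ s j' := by simpa using (Finset.mem_filter.1 hj').2 j
    rcases h j' with h2 | h2
    · exact absurd h1 (not_le.2 h2)
    · exact h2.2

/-- Each pair of a position `j` and an assignment `y` gives a term, the certificate of `g j` at `y`.
With the terms in order of decreasing score, then increasing position, the first satisfied one names
the attended position. The list may be very long, but only its width enters the switching bound. -/
theorem exists_decisionList_attention [Fintype ι] {c n : ℕ} {g : Fin (n + 1) → (ι → Bool) → B}
    (hg : ∀ j, DecisionTree c (g j)) (score : B → ℝ) :
    ∃ m, DecisionList c m fun x => g (firstArgmax fun j => score (g j x)) x := by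
  classical
  have : Inhabited B := ⟨g 0 fun _ => false⟩
  choose V hV hc using fun j => (hg j).exists_certificate
  obtain ⟨m, f, hf, h⟩ := exists_decisionList_of_keys (c := c)
    (fun p : Fin (n + 1) × (ι → Bool) => toLex (-score (g p.1 p.2), p.1)) (fun p => V p.1 p.2)
    (fun p => p.2) (fun p => g p.1 p.2) (fun p => hV _ _) Finset.univ
  refine ⟨m, ?_⟩
  convert hf using 1
  funext x
  -- Every `x` satisfies the terms of its own certificates, so the default value of the list is
  -- never reached.
  obtain ⟨⟨j, y⟩, -, hs, hv, hk⟩ := h x ⟨(0, x), Finset.mem_univ _, fun _ _ => rfl⟩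
  have hxy : g j x = g j y := hc j y x hs
  have hj : firstArgmax (fun j => score (g j x)) = j := by
    apply firstArgmax_eq
    intro j'
    have := hk (j', x) (Finset.mem_univ _) fun _ _ => rfl
    rw [Prod.Lex.toLex_le_toLex] at this
    simp only [← hxy, neg_lt_neg_iff, neg_inj] at this
    exact this.imp_right fun h => ⟨h.1.symm, h.2⟩
  rw [hj, hv, hxy]

end Trees

open scoped BigOperators

/-! ### Random restrictions and the switching lemma -/

section Restrictions

variable {ι B : Type*} {q : ℕ}

/-- A restriction fixes each variable to a value, unless its color is `0`. -/
def fillFree (ω : ι → Bool × Fin (q + 1)) (x : ι → Bool) : ι → Bool :=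
  fun i => if (ω i).2 = 0 then x i else (ω i).1

variable [DecidableEq ι]

theorem fillFree_update_free (ω : ι → Bool × Fin (q + 1)) (x : ι → Bool) (v : ι) (b d : Bool) :
    fillFree (Function.update ω v (b, 0)) (Function.update x v d) =
      Function.update (fillFree ω x) v d := by
  funext i
  by_cases h : i = v
  · subst h
    simp [fillFree]
  · simp [fillFree, h]

theorem fillFree_update_fixed (ω : ι → Bool × Fin (q + 1)) (x : ι → Bool) (v : ι) (b : Bool)
    {k : Fin (q + 1)} (hk : k ≠ 0) :
    fillFree (Function.update ω v (b, k)) x = Function.update (fillFree ω x) v b := by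
  funext i
  by_cases h : i = v
  · subst h
    simp [fillFree, hk]
  · simp [fillFree, h]

theorem fillFree_update_of_free (ω : ι → Bool × Fin (q + 1)) (x : ι → Bool) {v : ι} (d : Bool)
    (hv : (ω v).2 = 0) :
    fillFree ω (Function.update x v d) = Function.update (fillFree ω x) v d := by
  funext i
  by_cases h : i = v
  · subst h
    simp [fillFree, hv]
  · simp [fillFree, h]

variable [Fintype ι]

/-- Resampling one coordinate preserves the uniform measure: swapping the old and the new value is
an involution. -/
theorem expect_expect_update {Ω : Type*} [Fintype Ω] [Nonempty Ω] (v : ι) (F : (ι → Ω) → ℝ) :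
    𝔼 ω : ι → Ω, 𝔼 o : Ω, F (Function.update ω v o) = 𝔼 ω, F ω := by
  have h1 : 𝔼 ω : ι → Ω, 𝔼 o : Ω, F (Function.update ω v o) =
      𝔼 p : (ι → Ω) × Ω, F (Function.update p.1 v p.2) := by
    rw [← Finset.univ_product_univ, Finset.expect_product]
  have h2 : 𝔼 p : (ι → Ω) × Ω, F (Function.update p.1 v p.2) =
      𝔼 p : (ι → Ω) × Ω, F p.1 := by
    have hinv : Function.Involutive
        fun p : (ι → Ω) × Ω => (Function.update p.1 v p.2, p.1 v) := by
      rintro ⟨ω, o⟩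
      simp
    exact Fintype.expect_equiv hinv.toPerm _ _ fun p => rfl
  rw [h1, h2, ← Finset.univ_product_univ, Finset.expect_product]
  simp

/-- Random fixed bits together with random free bits form a uniform string. The involution `e`
exchanges, at the fixed coordinates, the bit of `ω` with the unused bit of `x`. -/
theorem expect_expect_fillFree (h : (ι → Bool) → ℝ) :
    𝔼 ω : ι → Bool × Fin (q + 1), 𝔼 x, h (fillFree ω x) = 𝔼 x, h x := by
  let e : (ι → Bool × Fin (q + 1)) × (ι → Bool) → (ι → Bool × Fin (q + 1)) × (ι → Bool) :=
    fun p => (fun i => if (p.1 i).2 = 0 then p.1 i else (p.2 i, (p.1 i).2), fillFree p.1 p.2)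
  have hinv : Function.Involutive e := by
    rintro ⟨ω, x⟩
    refine Prod.ext (funext fun i => ?_) (funext fun i => ?_)
    · by_cases hi : (ω i).2 = 0 <;> simp [e, fillFree, hi]
    · by_cases hi : (ω i).2 = 0 <;> simp [e, fillFree, hi]
  have h1 : 𝔼 p : (ι → Bool × Fin (q + 1)) × (ι → Bool), h (fillFree p.1 p.2) =
      𝔼 p : (ι → Bool × Fin (q + 1)) × (ι → Bool), h p.2 :=
    Fintype.expect_equiv hinv.toPerm _ _ fun p => rfl
  rw [← Finset.univ_product_univ, Finset.expect_product, Finset.expect_product] at h1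
  rw [h1]
  simp

theorem expect_bool_color (u : Bool → ℝ) (w : ℝ) :
    𝔼 o : Bool × Fin (q + 1), (u o.1 + if o.2 = 0 then w else 0) =
      (u true + u false) / 2 + w / (q + 1) := by
  rw [Finset.expect_add_distrib, ← Finset.univ_product_univ, Finset.expect_product,
    Finset.expect_product]
  simp only [Finset.expect_const Finset.univ_nonempty, Fintype.expect_eq_sum_div_card,
    Finset.sum_ite_eq', Fintype.sum_bool, Fintype.card_bool, Fintype.card_fin]
  simp

/-- The probability that a function restricted at random has no decision tree of depth
less than `t`. -/
noncomputable def failProb (q t : ℕ) (f : (ι → Bool) → B) : ℝ := by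
  classical
  exact 𝔼 ω : ι → Bool × Fin (q + 1),
    if ∀ s < t, ¬ DecisionTree s fun x => f (fillFree ω x) then 1 else 0

theorem failProb_le_one (q t : ℕ) (f : (ι → Bool) → B) : failProb q t f ≤ 1 := by
  unfold failProb
  exact Finset.expect_le Finset.univ_nonempty fun ω _ => by split_ifs <;> simp

theorem failProb_succ_const (q t : ℕ) (b : B) :
    failProb q (t + 1) (fun _ : ι → Bool => b) = 0 := by
  unfold failProb
  refine Finset.expect_eq_zero fun ω _ => if_neg fun h => ?_
  exact h 0 (Nat.succ_pos t) (.const _ _ fun _ _ => rfl)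

/-- Condition on what the restriction does to `v`. If `v` is fixed, the average over its value gives
the first summand. If it is free, querying it costs one level, so failure forces one of the two
branches to fail at depth `t`; this event has weight `1/(q+1)`. -/
theorem failProb_succ_le (q t : ℕ) (f : (ι → Bool) → B) (v : ι) :
    failProb q (t + 1) f ≤
      (failProb q (t + 1) (fun x => f (Function.update x v true)) +
        failProb q (t + 1) (fun x => f (Function.update x v false))) / 2 +
      (failProb q t (fun x => f (Function.update x v true)) +
        failProb q t (fun x => f (Function.update x v false))) / (q + 1) := by
  classical
  let bad : ℕ → ((ι → Bool) → B) → (ι → Bool × Fin (q + 1)) → ℝ := fun t f ω =>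
    if ∀ s < t, ¬ DecisionTree s fun x => f (fillFree ω x) then 1 else 0
  have hbad : ∀ t f, failProb q t f = 𝔼 ω, bad t f ω := fun t f => by
    unfold failProb
    rfl
  have h0 : ∀ t f ω, 0 ≤ bad t f ω := fun t f ω => by
    simp only [bad]
    split_ifs <;> simp
  let r : Bool → (ι → Bool) → B := fun b x => f (Function.update x v b)
  have key : ∀ ω b k, bad (t + 1) f (Function.update ω v (b, k)) ≤
      bad (t + 1) (r b) ω +
        if k = 0 then bad t (r true) ω + bad t (r false) ω else 0 := by
    intro ω b k
    by_cases hk : k = 0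
    · subst hk
      rw [if_pos rfl]
      refine le_trans ?_ (le_add_of_nonneg_left (h0 _ _ _))
      by_cases hT : ∀ s < t, ¬ DecisionTree s fun x => r true (fillFree ω x)
      · have h1 : bad t (r true) ω = 1 := if_pos hT
        have h2 : bad (t + 1) f (Function.update ω v (b, 0)) ≤ 1 := by
          simp only [bad]
          split_ifs <;> simp
        linarith [h0 t (r false) ω]
      by_cases hF : ∀ s < t, ¬ DecisionTree s fun x => r false (fillFree ω x)
      · have h1 : bad t (r false) ω = 1 := if_pos hF
        have h2 : bad (t + 1) f (Function.update ω v (b, 0)) ≤ 1 := by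
          simp only [bad]
          split_ifs <;> simp
        linarith [h0 t (r true) ω]
      push Not at hT hF
      obtain ⟨s, hs, hT⟩ := hT
      obtain ⟨s', hs', hF⟩ := hF
      obtain ⟨t, rfl⟩ : ∃ t', t = t' + 1 := ⟨t - 1, by omega⟩
      have h1 : bad (t + 1 + 1) f (Function.update ω v (b, 0)) = 0 := by
        refine if_neg fun h => h (t + 1) (by omega) (.query _ _ v fun d => ?_)
        simp only [fillFree_update_free]
        cases d
        · exact hF.mono (by omega)
        · exact hT.mono (by omega)
      rw [h1]
      exact add_nonneg (h0 _ _ _) (h0 _ _ _)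
    · rw [if_neg hk, add_zero]
      simp only [bad, r, fillFree_update_fixed _ _ _ _ hk, le_refl]
  calc failProb q (t + 1) f
      = 𝔼 ω, 𝔼 o, bad (t + 1) f (Function.update ω v o) := by
        rw [hbad, expect_expect_update]
    _ ≤ 𝔼 ω : ι → Bool × Fin (q + 1), 𝔼 o : Bool × Fin (q + 1), (bad (t + 1) (r o.1) ω +
          if o.2 = 0 then bad t (r true) ω + bad t (r false) ω else 0) :=
        Finset.expect_le_expect fun ω _ => Finset.expect_le_expect fun o _ => key ω o.1 o.2
    _ = _ := by
        simp_rw [hbad]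
        rw [Finset.expect_congr rfl fun ω _ => expect_bool_color (fun b => bad (t + 1) (r b) ω) _]
        simp only [Finset.expect_add_distrib, ← Finset.expect_div]
        rfl

/-- A weak form of the switching lemma: a randomly restricted decision list of width `c` is
unlikely to have no decision tree of small depth. -/
theorem DecisionList.failProb_le {c n : ℕ} {f : (ι → Bool) → B} (h : DecisionList c n f)
    (q t : ℕ) : failProb q t f ≤ (4 * 2 ^ c / (q + 1)) ^ t := by
  set X : ℝ := 4 * 2 ^ c / (q + 1) with hX
  have hX0 : 0 < X := by positivity
  induction n generalizing f t with
  | zero =>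
    cases h
    cases t with
    | zero => simpa using failProb_le_one _ _ _
    | succ t => rw [failProb_succ_const]; positivity
  | succ n ih =>
    induction t generalizing f with
    | zero => simpa using failProb_le_one _ _ _
    | succ t iht =>
      -- Query the variables of the first term one at a time. With `ε = (1/2) ^ c`, the coefficient
      -- `A m = (1 + ε) * (1 - (1/2) ^ m)` solves `A 0 = 0`, `A (m + 1) = (A m + 1) / 2 + ε / 2`:
      -- the agreeing value leaves `m` variables, the other deletes the term, and a free variable
      -- contributes `ε / 2`. The condition `m ≤ c` ensures `A m ≤ 1`.
      have main : ∀ m (V : Finset ι), V.card = m → m ≤ c → ∀ (a : ι → Bool) (b : B) (f),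
          DecisionList c n f →
          failProb q (t + 1) (prependTerm V a b f) ≤
            (1 - ((1 + (1 / 2) ^ c) * (1 / 2) ^ m - (1 / 2) ^ c)) * X ^ (t + 1) := by
        intro m
        induction m with
        | zero =>
          intro V hV _ a b f hf
          rw [Finset.card_eq_zero] at hV
          subst hV
          have : prependTerm ∅ a b f = fun _ => b := funext fun x => if_pos (by simp)
          rw [this, failProb_succ_const]
          simp
        | succ m ihm =>
          intro V hV hm a b f hf
          obtain ⟨v, hv⟩ : V.Nonempty := Finset.card_pos.1 (by omega)
          have hg : DecisionList c (n + 1) (prependTerm V a b f) :=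
            .cons n V a b f (by omega) hf
          have h1 : ∀ d, failProb q t (fun x => prependTerm V a b f
              (Function.update x v d)) ≤ X ^ t := fun d => iht (hg.comp_update v d)
          have h2 : failProb q (t + 1) (fun x => prependTerm V a b f
              (Function.update x v (a v))) ≤
                (1 - ((1 + (1 / 2) ^ c) * (1 / 2) ^ m - (1 / 2) ^ c)) * X ^ (t + 1) := by
            refine le_of_eq_of_le ?_ (ihm (V.erase v) (by rw [Finset.card_erase_of_mem hv]; omega)
              (by omega) a b _ (hf.comp_update v (a v)))
            rw [prependTerm_comp_update b f fun _ => rfl]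
          have h3 : failProb q (t + 1) (fun x => prependTerm V a b f
              (Function.update x v (!(a v)))) ≤ X ^ (t + 1) := by
            refine le_of_eq_of_le ?_ (ih (hf.comp_update v (!(a v))) (t + 1))
            congr 1
            funext x
            refine if_neg fun h => ?_
            simpa using h v hv
          refine (failProb_succ_le q t _ v).trans ?_
          -- The factor `4 * 2 ^ c` in `X` is chosen for this identity.
          have h4 : X ^ t / (q + 1) = X ^ (t + 1) * ((1 / 2) ^ c / 4) := by
            rw [pow_succ, hX, one_div, inv_pow]
            field_simp
          have h5 : ((1 : ℝ) / 2) ^ (m + 1) = (1 / 2) ^ m / 2 := by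
            rw [pow_succ]
            ring
          have h6 := div_le_div_of_nonneg_right (add_le_add (h1 true) (h1 false))
            (by positivity : (0 : ℝ) ≤ (q : ℝ) + 1)
          rw [← two_mul, mul_div_assoc, h4] at h6
          rw [h5]
          refine (add_le_add (div_le_div_of_nonneg_right ?_ two_pos.le) h6).trans_eq
            (b := (((1 - ((1 + (1 / 2) ^ c) * (1 / 2) ^ m - (1 / 2) ^ c)) * X ^ (t + 1) +
              X ^ (t + 1)) / 2) + 2 * (X ^ (t + 1) * ((1 / 2) ^ c / 4))) ?_
          · cases hav : a v
            · rw [hav] at h2 h3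
              rw [add_comm]
              exact add_le_add h2 h3
            · rw [hav] at h2 h3
              exact add_le_add h2 h3
          · ring
      cases h with
      | const n b => rw [failProb_succ_const]; positivity
      | cons n V a b f hV h =>
        refine (main _ V rfl hV a b f h).trans ?_
        refine mul_le_of_le_one_left (by positivity) ?_
        have h1 : ((1 : ℝ) / 2) ^ c ≤ (1 / 2) ^ V.card :=
          pow_le_pow_of_le_one (by norm_num) (by norm_num) hV
        have h2 : (0 : ℝ) ≤ (1 / 2) ^ c * (1 / 2) ^ V.card := by positivity
        linarith

end Restrictions

/-! ### Restricting the transformer layer by layer -/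

section Layers

variable {ι : Type*} [DecidableEq ι] {q : ℕ}

theorem DecisionTree.comp_fillFree {B : Type*} {s : ℕ} {f : (ι → Bool) → B}
    (h : DecisionTree s f) (ω : ι → Bool × Fin (q + 1)) :
    DecisionTree s fun x => f (fillFree ω x) := by
  induction h with
  | const s f h => exact .const _ _ fun x y => h _ _
  | query s f v h ih =>
    by_cases hv : (ω v).2 = 0
    · refine .query _ _ v fun b => ?_
      simp only [fillFree_update_of_free ω _ _ hv]
      exact ih b
    · convert (ih (ω v).1).mono (Nat.le_succ s) using 2 with x
      congr 1
      rw [eq_comm, Function.update_eq_self_iff]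
      simp [fillFree, hv]

variable [Fintype ι]

theorem expect_prod_apply {Ω : Type*} [Fintype Ω] (G : ι → Ω → ℝ) :
    𝔼 ω : ι → Ω, ∏ i, G i (ω i) = ∏ i, 𝔼 o, G i o := by
  simp only [Fintype.expect_eq_sum_div_card, Finset.prod_div_distrib, Finset.prod_univ_sum,
    Fintype.piFinset_univ, Finset.prod_const, Finset.card_univ, Fintype.card_fun, Nat.cast_pow]

/-- By independence each element of `S` contributes a factor with mean `1 - r / (q + 1)`. Thus a
power of `1 - r` measures the number of free variables and its expectation is exact, so no
concentration bound is needed. -/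
theorem expect_pow_card_free (S : Finset ι) (r : ℝ) :
    𝔼 ω : ι → Bool × Fin (q + 1), (1 - r) ^ (S.filter fun i => (ω i).2 = 0).card =
      (1 - r / (q + 1)) ^ S.card := by
  have h := expect_prod_apply (ι := ι)
    fun i (o : Bool × Fin (q + 1)) => if i ∈ S then (1 + if o.2 = 0 then -r else 0) else 1
  have h1 : 𝔼 o : Bool × Fin (q + 1), (1 + if o.2 = 0 then -r else 0) = 1 - r / (q + 1) := by
    rw [expect_bool_color (fun _ => 1) (-r)]
    ring
  have h2 : ∀ i, 𝔼 o : Bool × Fin (q + 1), (if i ∈ S then (1 + if o.2 = 0 then -r else 0) else 1) =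
      if i ∈ S then 1 - r / (q + 1) else 1 := by
    intro i
    split_ifs
    · exact h1
    · simp
  simp only [h2, Finset.prod_ite_mem, Finset.univ_inter, Finset.prod_const] at h
  rw [← h]
  refine Finset.expect_congr rfl fun ω _ => ?_
  rw [← Finset.prod_const, Finset.prod_filter]
  refine Finset.prod_congr rfl fun i _ => ?_
  split_ifs <;> ring

variable {S E P A : Type*} (T : HardAttentionTransformer S E P A)

namespace HardAttentionTransformer

/-- One layer: if all activations have shallow decision trees, then some restriction of the
variables makes all activations of the next layer have shallow decision trees, while keeping
`bal` likely and many variables free. -/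
theorem exists_restriction_layer {n c₀ c s : ℕ} (X : (ι → Bool) → Fin (n + 1) → Option S)
    (k : Fin T.numLayers) (θ : (ι → Bool) → ι → Bool) (F : Finset ι)
    (bal : (ι → Bool) → Prop) [DecidablePred bal] {r M β : ℝ} (hr : r ≤ 1) (hM : 0 ≤ M)
    (hθ : ∀ v ∈ F, ∀ x b, θ (Function.update x v b) = Function.update (θ x) v b)
    (hc : c₀ ≤ c)
    (hY : ∀ i, DecisionTree c₀ fun x => T.activation (X (θ x)) k.castSucc i)
    (hβ : β ≤ (𝔼 x, if bal (θ x) then 1 else 0) - M * (1 - r / (q + 1)) ^ F.card)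
    (hpos : ((n : ℝ) + 1) * (T.numHeads * (2 ^ c * (4 * 2 ^ c / (q + 1)) ^ (s + 1))) < β) :
    ∃ (θ' : (ι → Bool) → ι → Bool) (F' : Finset ι),
      (∀ v ∈ F', ∀ x b, θ' (Function.update x v b) = Function.update (θ' x) v b) ∧
      (∀ i, DecisionTree (c₀ + T.numHeads * s) fun x => T.activation (X (θ' x)) k.succ i) ∧
      β - (n + 1) * (T.numHeads * (2 ^ c * (4 * 2 ^ c / (q + 1)) ^ (s + 1))) ≤
        (𝔼 x, if bal (θ' x) then 1 else 0) - M * (1 - r) ^ F'.card := by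
  classical
  set δ : ℝ := (4 * 2 ^ c / (q + 1)) ^ (s + 1) with hδ
  have hδ0 : 0 ≤ δ := by positivity
  set Y : Fin (n + 1) → (ι → Bool) → A := fun i x => T.activation (X (θ x)) k.castSucc i with hYdef
  choose R hRcard hR using fun i => (hY i).exists_range
  -- The attending activation is frozen to `a`; only then is the head a decision list. At position
  -- `i` only the at most `2 ^ c` values in `R i` matter.
  let g : Fin T.numHeads → A → (ι → Bool) → A :=
    fun h a x => Y (firstArgmax fun j => T.att k h a (Y j x)) x
  have hg : ∀ h a, failProb q (s + 1) (g h a) ≤ δ := fun h a => by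
    obtain ⟨m, hm⟩ := exists_decisionList_attention (fun i => (hY i).mono hc) (T.att k h a)
    exact hm.failProb_le q (s + 1)
  let bad : Fin T.numHeads → A → (ι → Bool × Fin (q + 1)) → ℝ := fun h a ω =>
    if ∀ t < s + 1, ¬ DecisionTree t fun x => g h a (fillFree ω x) then 1 else 0
  have hbad0 : ∀ h a ω, 0 ≤ bad h a ω := fun h a ω => by
    simp only [bad]
    split_ifs <;> simp
  have hbad : ∀ h a, 𝔼 ω, bad h a ω ≤ δ := fun h a => by
    refine le_of_eq_of_le ?_ (hg h a)
    unfold failProb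
    rfl
  let total : (ι → Bool × Fin (q + 1)) → ℝ := fun ω => ∑ i, ∑ h, ∑ a ∈ R i, bad h a ω
  have htotal : 𝔼 ω, total ω ≤ (n + 1) * (T.numHeads * (2 ^ c * δ)) := by
    simp only [total, Finset.expect_sum_comm]
    have hi : ∀ i : Fin (n + 1), ∑ h, ∑ a ∈ R i, 𝔼 ω, bad h a ω ≤ T.numHeads * (2 ^ c * δ) := by
      intro i
      have : ∀ h, ∑ a ∈ R i, 𝔼 ω, bad h a ω ≤ 2 ^ c * δ := fun h => by
        refine (Finset.sum_le_card_nsmul _ _ δ fun a _ => hbad h a).trans ?_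
        rw [nsmul_eq_mul]
        refine mul_le_mul_of_nonneg_right ?_ hδ0
        exact_mod_cast (hRcard i).trans (Nat.pow_le_pow_right two_pos hc)
      refine (Finset.sum_le_card_nsmul _ _ _ fun h _ => this h).trans ?_
      simp
    refine (Finset.sum_le_card_nsmul _ _ _ fun i _ => hi i).trans ?_
    simp
  let free : (ι → Bool × Fin (q + 1)) → Finset ι := fun ω => F.filter fun i => (ω i).2 = 0
  -- One quantity combines the balance probability, the penalty for few free variables and the
  -- number of failures, so a single averaging argument controls all three.
  let W : (ι → Bool × Fin (q + 1)) → ℝ := fun ω =>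
    (𝔼 x, if bal (θ (fillFree ω x)) then 1 else 0) - M * (1 - r) ^ (free ω).card - total ω
  have hW : β - (n + 1) * (T.numHeads * (2 ^ c * δ)) ≤ 𝔼 ω, W ω := by
    simp only [W, Finset.expect_sub_distrib, ← Finset.mul_expect, free, expect_pow_card_free]
    rw [expect_expect_fillFree fun x => if bal (θ x) then 1 else 0]
    linarith
  obtain ⟨ω, -, hω⟩ := Finset.exists_le_of_le_expect Finset.univ_nonempty hW
  have ht0 : 0 ≤ total ω := Finset.sum_nonneg fun i _ => Finset.sum_nonneg fun h _ =>
    Finset.sum_nonneg fun a _ => hbad0 h a ω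
  have hM0 : 0 ≤ M * (1 - r) ^ (free ω).card :=
    mul_nonneg hM (pow_nonneg (by linarith) _)
  -- `total ω` counts failures, so being below `1` excludes every one of them.
  have ht1 : total ω < 1 := by
    have h1 : (𝔼 x, if bal (θ (fillFree ω x)) then (1 : ℝ) else 0) ≤ 1 :=
      Finset.expect_le Finset.univ_nonempty fun x _ => by split_ifs <;> simp
    simp only [W] at hω
    linarith
  have hgood : ∀ i h, ∀ a ∈ R i, DecisionTree s fun x => g h a (fillFree ω x) := by
    intro i h a ha
    by_contra hcon
    have h1 : bad h a ω = 1 :=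
      if_pos fun t ht hd => hcon (hd.mono (by omega))
    have h2 : bad h a ω ≤ total ω :=
      (Finset.single_le_sum (f := fun a => bad h a ω) (fun a _ => hbad0 h a ω) ha).trans <|
        (Finset.single_le_sum (f := fun h => ∑ a ∈ R i, bad h a ω)
          (fun h _ => Finset.sum_nonneg fun a _ => hbad0 h a ω) (Finset.mem_univ h)).trans <|
        Finset.single_le_sum (f := fun i => ∑ h, ∑ a ∈ R i, bad h a ω)
          (fun i _ => Finset.sum_nonneg fun h _ => Finset.sum_nonneg fun a _ => hbad0 h a ω)
          (Finset.mem_univ i)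
    linarith
  refine ⟨fun x => θ (fillFree ω x), free ω, fun v hv x b => ?_, fun i => ?_, ?_⟩
  · rw [Finset.mem_filter] at hv
    simp only [fillFree_update_of_free ω x b hv.2, hθ v hv.1]
  -- Evaluate the attending activation first, then all heads for that value.
  · exact ((hY i).comp_fillFree ω).bind
      (g := fun a x => T.act k a fun h => g h a (fillFree ω x))
      fun x => (DecisionTree.pi fun h => hgood i h _ (hR i _)).map _
  · simp only [W] at hω
    linarith

/-- Apply `exists_restriction_layer` once per layer. The rate `r` grows by the factor `q + 1` each
time, from `(1/(q+1)) ^ L / 2` to `1/2`, where `L` is the number of layers, and each layer costs at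
most `Δ` of the potential. -/
theorem exists_flip_activation_eq {n c s : ℕ} (q : ℕ) (X : (ι → Bool) → Fin (n + 1) → Option S)
    (hX : ∀ i, DecisionTree 1 fun x => X x i) (bal : (ι → Bool) → Prop) [DecidablePred bal]
    (hc : 1 + T.numLayers * (T.numHeads * s) ≤ c)
    (hpos : (T.numLayers : ℝ) *
        ((n + 1) * (T.numHeads * (2 ^ c * (4 * 2 ^ c / (q + 1)) ^ (s + 1)))) <
      (𝔼 x, if bal x then 1 else 0) -
        2 ^ c * (1 - (1 / (q + 1)) ^ T.numLayers / 2) ^ Fintype.card ι) :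
    ∃ x v, bal x ∧
      T.activation (X (Function.update x v (!(x v)))) (Fin.last _) (Fin.last n) =
        T.activation (X x) (Fin.last _) (Fin.last n) := by
  set Δ : ℝ := (n + 1) * (T.numHeads * (2 ^ c * (4 * 2 ^ c / (q + 1)) ^ (s + 1))) with hΔ
  have hΔ0 : 0 ≤ Δ := by positivity
  set β : ℝ := (𝔼 x, if bal x then 1 else 0) -
    2 ^ c * (1 - (1 / (q + 1)) ^ T.numLayers / 2) ^ Fintype.card ι with hβ
  have hlayer : ∀ k : Fin (T.numLayers + 1),
      ∃ (θ : (ι → Bool) → ι → Bool) (F : Finset ι),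
        (∀ v ∈ F, ∀ x b, θ (Function.update x v b) = Function.update (θ x) v b) ∧
        (∀ i, DecisionTree (1 + k * (T.numHeads * s)) fun x => T.activation (X (θ x)) k i) ∧
        β - k * Δ ≤ (𝔼 x, if bal (θ x) then 1 else 0) -
          2 ^ c * (1 - (1 / (q + 1)) ^ (T.numLayers - k : ℕ) / 2) ^ F.card := by
    intro k
    induction k using Fin.induction with
    | zero =>
      refine ⟨id, Finset.univ, fun v _ x b => rfl, fun i => ?_, ?_⟩
      · exact ((hX i).map fun a => T.combine (T.embed a) (T.pos (i + 1))).mono (by simp)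
      · simp [hβ]
    | succ k ih =>
      obtain ⟨θ, F, hθ, hY, hk⟩ := ih
      have hkL := k.isLt
      have hkΔ : ((k : ℝ) + 1) * Δ ≤ T.numLayers * Δ := by
        refine mul_le_mul_of_nonneg_right ?_ hΔ0
        exact_mod_cast hkL
      have hq : (1 : ℝ) / (q + 1) ≤ 1 := by
        rw [div_le_one (by positivity)]
        linarith [(Nat.cast_nonneg q : (0 : ℝ) ≤ q)]
      have hr : (1 / ((q : ℝ) + 1)) ^ (T.numLayers - (k + 1)) / 2 ≤ 1 := by
        have := pow_le_one₀ (n := T.numLayers - (k + 1)) (by positivity) hq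
        linarith
      have h1 : 1 + k * (T.numHeads * s) ≤ c := by
        refine le_trans ?_ hc
        gcongr
      have h2 : β - k * Δ ≤ (𝔼 x, if bal (θ x) then 1 else 0) - 2 ^ c *
          (1 - (1 / ((q : ℝ) + 1)) ^ (T.numLayers - (k + 1)) / 2 / (q + 1)) ^ F.card := by
        refine hk.trans_eq ?_
        rw [Fin.val_castSucc, show T.numLayers - (k : ℕ) = T.numLayers - (k + 1) + 1 by omega,
          pow_succ]
        ring
      obtain ⟨θ', F', hθ', hY', hk'⟩ := T.exists_restriction_layer (q := q) (s := s) X k θ F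
        bal hr (by positivity) hθ h1 hY h2 (by linarith)
      refine ⟨θ', F', hθ', fun i => (hY' i).mono (le_of_eq ?_), ?_⟩
      · simp only [Fin.val_succ]
        ring
      · refine le_trans (le_of_eq ?_) hk'
        simp only [Fin.val_succ, ← hΔ]
        push_cast
        ring
  obtain ⟨θ, F, hθ, hY, hF⟩ := hlayer (Fin.last _)
  simp only [Fin.val_last, Nat.sub_self, pow_zero] at hF
  have hpos' : 0 < (𝔼 x, if bal (θ x) then (1 : ℝ) else 0) - 2 ^ c * (1 - 1 / 2) ^ F.card := by
    linarith
  -- With final rate `1/2`, the weight `2 ^ c` makes the penalty at least `1` as soon as at most `c`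
  -- variables are free.
  have hcard : c < F.card := by
    by_contra hcon
    have h1 : (𝔼 x, if bal (θ x) then (1 : ℝ) else 0) ≤ 1 :=
      Finset.expect_le Finset.univ_nonempty fun x _ => by split_ifs <;> simp
    have h2 : ((1 : ℝ) / 2) ^ c ≤ (1 / 2) ^ F.card :=
      pow_le_pow_of_le_one (by norm_num) (by norm_num) (not_lt.1 hcon)
    have h3 : (2 : ℝ) ^ c * (1 / 2) ^ c = 1 := by
      rw [← mul_pow]
      norm_num
    have h4 := mul_le_mul_of_nonneg_left h2 (by positivity : (0 : ℝ) ≤ 2 ^ c)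
    rw [h3] at h4
    rw [show (1 : ℝ) - 1 / 2 = 1 / 2 by norm_num] at hpos'
    linarith
  obtain ⟨x, hx⟩ : ∃ x, bal (θ x) := by
    by_contra! hcon
    have : (𝔼 x, if bal (θ x) then (1 : ℝ) else 0) = 0 :=
      Finset.expect_eq_zero fun x _ => if_neg (hcon x)
    rw [this] at hpos'
    have : (0 : ℝ) ≤ 2 ^ c * (1 - 1 / 2) ^ F.card := by norm_num
    linarith
  -- The certificate has at most `c` variables, fewer than are free, so a free variable lies outside
  -- it.
  obtain ⟨V, hV, hVx⟩ := (hY (Fin.last n)).exists_certificate x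
  obtain ⟨v, hvF, hvV⟩ : ∃ v ∈ F, v ∉ V :=
    Finset.exists_mem_notMem_of_card_lt_card ((hV.trans hc).trans_lt hcard)
  refine ⟨θ x, v, hx, ?_⟩
  rw [← hθ v hvF]
  refine hVx _ fun w hw => Function.update_of_ne ?_ _ _
  rintro rfl
  exact hvV hw

end HardAttentionTransformer

end Layers

/-! ### Choice of parameters -/

theorem eventually_div_add_pow_mul_exp_neg_lt_one (a b : ℝ) (d : ℕ) :
    ∀ᶠ Q : ℕ in Filter.atTop, a / Q + b * ((Q : ℝ) ^ d * Real.exp (-Q)) < 1 := by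
  have h1 : Filter.Tendsto (fun Q : ℕ => a / (Q : ℝ)) Filter.atTop (nhds 0) :=
    tendsto_const_div_atTop_nhds_zero_nat a
  have h2 : Filter.Tendsto (fun Q : ℕ => b * ((Q : ℝ) ^ d * Real.exp (-Q))) Filter.atTop
      (nhds (b * 0)) :=
    ((Real.tendsto_pow_mul_exp_neg_atTop_nhds_zero d).comp
      tendsto_natCast_atTop_atTop).const_mul b
  have h3 := h1.add h2
  rw [mul_zero, add_zero] at h3
  exact h3.eventually_lt_const one_pos

theorem exists_pow_le_lt_pow {D N Q₀ : ℕ} (hN : Q₀ ^ D ≤ N) (h1 : 1 ≤ N) (hD : D ≠ 0) :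
    ∃ Q, Q₀ ≤ Q ∧ 1 ≤ Q ∧ Q ^ D ≤ N ∧ N < (Q + 1) ^ D := by
  refine ⟨Nat.findGreatest (fun Q => Q ^ D ≤ N) N, ?_, ?_, ?_, ?_⟩
  · exact Nat.le_findGreatest ((Nat.le_self_pow hD Q₀).trans hN) hN
  · exact Nat.le_findGreatest h1 (by simpa using h1)
  · exact Nat.findGreatest_spec (P := fun Q => Q ^ D ≤ N) h1 (by simpa using h1)
  · by_contra hcon
    have h2 := Nat.le_findGreatest (P := fun Q => Q ^ D ≤ N) (n := N)
      ((Nat.le_self_pow hD _).trans (not_lt.1 hcon)) (not_lt.1 hcon)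
    omega

/-- The central binomial coefficient is at least `4 ^ N / (2 * N + 1)`. -/
theorem one_div_le_expect_balanced (N : ℕ) :
    1 / (2 * N + 1 : ℝ) ≤ 𝔼 x : Fin (2 * N) → Bool,
      if (Finset.univ.filter fun i => x i = true).card = N then 1 else 0 := by
  have hcard : (Finset.univ.filter fun x : Fin (2 * N) → Bool =>
      (Finset.univ.filter fun i => x i = true).card = N).card = (2 * N).choose N := by
    have h := Finset.card_powersetCard N (Finset.univ : Finset (Fin (2 * N)))
    rw [Finset.card_univ, Fintype.card_fin] at h
    rw [← h]
    refine Finset.card_nbij' (fun x => Finset.univ.filter fun i => x i = true)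
      (fun s i => decide (i ∈ s)) ?_ ?_ ?_ ?_
    · intro x hx
      simpa [Finset.mem_powersetCard] using hx
    · intro s hs
      simpa [Finset.mem_powersetCard] using hs
    · intro x _
      funext i
      simp
    · intro s _
      ext i
      simp
  have h4 : (4 : ℝ) ^ N ≤ (2 * N + 1) * ((2 * N).choose N : ℕ) := by
    exact_mod_cast Nat.four_pow_le_two_mul_add_one_mul_central_binom N
  rw [Fintype.expect_eq_sum_div_card, Finset.sum_boole, hcard, Fintype.card_fun, Fintype.card_bool,
    Fintype.card_fin, pow_mul, div_le_div_iff₀ (by positivity) (by positivity)]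
  push_cast
  norm_num
  linarith

theorem card_filter_update_not {ι : Type*} [Fintype ι] [DecidableEq ι] (x : ι → Bool) (v : ι) :
    (Finset.univ.filter fun i => Function.update x v (!(x v)) i = true).card + 1 =
        (Finset.univ.filter fun i => x i = true).card ∨
      (Finset.univ.filter fun i => Function.update x v (!(x v)) i = true).card =
        (Finset.univ.filter fun i => x i = true).card + 1 := by
  cases hv : x v
  · right
    rw [← Finset.card_insert_of_notMem (a := v) (by simp [hv])]
    congr 1
    ext i
    by_cases h : i = v
    · subst h
      simp
    · simp [h]
  · left
    rw [← Finset.card_insert_of_notMem (a := v) (by simp)]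
    congr 1
    ext i
    by_cases h : i = v
    · subst h
      simp [hv]
    · simp [h]

theorem count_ofFn_eq_card {n : ℕ} (x : Fin n → Bool) (b : Bool) :
    (List.ofFn x).count b = (Finset.univ.filter fun i => x i = b).card := by
  rw [Finset.card_filter]
  induction n with
  | zero => simp
  | succ n ih =>
    rw [List.ofFn_succ, List.count_cons, ih, Fin.sum_univ_succ, add_comm]
    simp

theorem decisionTree_apply {ι B : Type*} [DecidableEq ι] (v : ι) (g : Bool → B) :
    DecisionTree 1 fun x : ι → Bool => g (x v) :=
  .query _ _ v fun b => .const _ _ fun x y => by simp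

theorem decisionTree_getElem_append {S : Type*} {m : ℕ} (l r : List S) (g : Bool → S) (i : ℕ) :
    DecisionTree 1 fun x : Fin m → Bool => (l ++ (List.ofFn x).map g ++ r)[i]? := by
  by_cases h1 : i < l.length
  · refine .const _ _ fun x y => ?_
    simp [List.getElem?_append, h1]
  by_cases h2 : i - l.length < m
  · convert decisionTree_apply (⟨i - l.length, h2⟩ : Fin m) fun b => some (g b) using 2 with x
    rw [List.append_assoc, List.getElem?_append_right (not_lt.1 h1),
      List.getElem?_append_left (by simpa using h2)]
    simp [h2]
  · refine .const _ _ fun x y => ?_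
    simp [List.getElem?_append, h1, h2]

namespace HardAttentionTransformer

variable {S E P A : Type*} (T : HardAttentionTransformer S E P A)

theorem finalActivation_eq (w : List S) {n : ℕ} (h : w.length = n) :
    T.finalActivation w =
      T.activation (n := n) (fun i => w[(i : ℕ)]?) (Fin.last _) (Fin.last n) := by
  subst h
  rfl

theorem accepts_congr {w w' : List S} (h : T.finalActivation w = T.finalActivation w') :
    T.Accepts w ↔ T.Accepts w' := by
  unfold Accepts labelProb
  rw [h]

/-- With `D = L + 1`, take `Q = q + 1` as the integer part of `N ^ (1/D)`. Tree depth `s = 2 * D`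
makes each failure probability `O(Q ^ (-(2 * D + 1)))`, that is `O(N ^ (-2) / Q)`, so the union over
`O(N)` positions is `o(1/N)`. The penalty for few free variables is at most `2 ^ c * exp (-Q)`,
since `Q ^ D ≤ N`. Both are eventually beaten by the balance probability, at least `1 / (3 * N)`. -/
theorem exists_flip_activation_eq_of_large : ∃ N₀, ∀ N ≥ N₀, ∀ n, n + 1 ≤ 5 * N →
    ∀ X : (Fin (2 * N) → Bool) → Fin (n + 1) → Option S,
      (∀ i, DecisionTree 1 fun x => X x i) →
      ∃ x v, (Finset.univ.filter fun i => x i = true).card = N ∧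
        T.activation (X (Function.update x v (!(x v)))) (Fin.last _) (Fin.last n) =
          T.activation (X x) (Fin.last _) (Fin.last n) := by
  set L := T.numLayers with hL
  set H := T.numHeads with hH
  obtain ⟨D, hD⟩ : ∃ D, D = L + 1 := ⟨_, rfl⟩
  obtain ⟨c, hc⟩ : ∃ c, c = 1 + L * (H * (2 * D)) := ⟨_, rfl⟩
  obtain ⟨K, hK⟩ : ∃ K : ℝ, K = 2 ^ c := ⟨_, rfl⟩
  have hK0 : 0 < K := by rw [hK]; positivity
  obtain ⟨C, hC⟩ : ∃ C : ℝ, C = L * H * K * (4 * K) ^ (2 * D + 1) := ⟨_, rfl⟩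
  have hC0 : 0 ≤ C := by rw [hC]; positivity
  obtain ⟨Q₀, hQ₀⟩ := Filter.eventually_atTop.1
    (eventually_div_add_pow_mul_exp_neg_lt_one (15 * 4 ^ D * C) (3 * K * 2 ^ D) D)
  refine ⟨max 1 (Q₀ ^ D), fun N hN n hn X hX => ?_⟩
  have hN1 : 1 ≤ N := (le_max_left _ _).trans hN
  obtain ⟨Q, hQ, hQ1, hQN, hNQ⟩ :=
    exists_pow_le_lt_pow ((le_max_right _ _).trans hN) hN1 (by omega : D ≠ 0)
  have hlt := hQ₀ Q hQ
  obtain ⟨q, rfl⟩ : ∃ q, Q = q + 1 := ⟨Q - 1, by omega⟩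
  refine T.exists_flip_activation_eq (c := c) (s := 2 * D) q X hX _ hc.ge ?_
  rw [Fintype.card_fin, ← hL, ← hH, ← hK]
  obtain ⟨R, hR⟩ : ∃ R : ℝ, R = q + 1 := ⟨_, rfl⟩
  have hR1 : 1 ≤ R := by rw [hR]; linarith [(Nat.cast_nonneg q : (0 : ℝ) ≤ q)]
  have hR0 : 0 < R := by linarith
  push_cast at hlt
  rw [← hR] at hlt ⊢
  have hNR : (N : ℝ) ≤ 2 ^ D * R ^ D := by
    rw [← mul_pow]
    have h1 : (N : ℝ) ≤ ((q : ℝ) + 1 + 1) ^ D := by exact_mod_cast hNQ.le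
    refine h1.trans (pow_le_pow_left₀ (by positivity) ?_ D)
    rw [← hR]
    linarith
  have hRN : R ^ D ≤ N := by
    rw [hR]
    exact_mod_cast hQN
  have hN0 : (0 : ℝ) < N := by exact_mod_cast hN1
  have hn' : (n : ℝ) + 1 ≤ 5 * N := by exact_mod_cast hn
  have hE : 1 / (3 * N : ℝ) ≤ 1 / (2 * N + 1) := by
    refine one_div_le_one_div_of_le (by positivity) ?_
    have : (1 : ℝ) ≤ N := by exact_mod_cast hN1
    linarith
  have hA : (L : ℝ) * ((n + 1) * (H * (K * (4 * K / R) ^ (2 * D + 1)))) ≤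
      15 * 4 ^ D * C / R / (3 * N) := by
    have h1 : (L : ℝ) * ((n + 1) * (H * (K * (4 * K / R) ^ (2 * D + 1)))) =
        (n + 1) * (C / R ^ (2 * D + 1)) := by
      rw [hC, div_pow]
      ring
    have h2 : (N : ℝ) * N ≤ 4 ^ D * R ^ (2 * D) := by
      refine (mul_le_mul hNR hNR hN0.le (by positivity)).trans_eq ?_
      rw [show (4 : ℝ) = 2 * 2 by norm_num, mul_pow, two_mul D, pow_add]
      ring
    have h3 : 0 ≤ C / R ^ (2 * D + 1) := by positivity
    rw [h1, le_div_iff₀ (by positivity)]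
    calc ((n : ℝ) + 1) * (C / R ^ (2 * D + 1)) * (3 * N)
        ≤ 5 * N * (C / R ^ (2 * D + 1)) * (3 * N) := by gcongr
      _ = 15 * (N * N) * (C / R ^ (2 * D + 1)) := by ring
      _ ≤ 15 * (4 ^ D * R ^ (2 * D)) * (C / R ^ (2 * D + 1)) := by gcongr
      _ = 15 * 4 ^ D * C / R := by
        rw [pow_succ R]
        field_simp
  have hB : K * (1 - (1 / R) ^ L / 2) ^ (2 * N) ≤
      3 * K * 2 ^ D * (R ^ D * Real.exp (-R)) / (3 * N) := by
    have h1 : (1 - (1 / R) ^ L / 2) ^ (2 * N) ≤ Real.exp (-R) := by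
      have h2 : (1 / R) ^ L ≤ 1 := pow_le_one₀ (by positivity) ((div_le_one hR0).2 hR1)
      have h3 : 1 - (1 / R) ^ L / 2 ≤ Real.exp (-((1 / R) ^ L / 2)) := by
        linarith [Real.add_one_le_exp (-((1 / R) ^ L / 2))]
      refine (pow_le_pow_left₀ (by linarith) h3 _).trans ?_
      rw [← Real.exp_nat_mul, Real.exp_le_exp]
      push_cast
      have h4 : R ≤ N * (1 / R) ^ L := by
        rw [one_div, inv_pow, ← div_eq_mul_inv, le_div_iff₀ (by positivity), ← pow_succ', ← hD]
        exact hRN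
      linarith
    rw [le_div_iff₀ (by positivity)]
    calc K * (1 - (1 / R) ^ L / 2) ^ (2 * N) * (3 * N)
        ≤ K * Real.exp (-R) * (3 * (2 ^ D * R ^ D)) := by gcongr
      _ = _ := by ring
  have hsum : 15 * 4 ^ D * C / R / (3 * N) +
      3 * K * 2 ^ D * (R ^ D * Real.exp (-R)) / (3 * N) < 1 / (3 * N) := by
    rw [← add_div]
    exact div_lt_div_of_pos_right hlt (by positivity)
  have := one_div_le_expect_balanced N
  linarith

/-- A balanced sequence of bits, placed between two fixed words, and the sequence with some bit
flipped are not distinguished. -/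
theorem exists_flip_accepts_iff : ∃ N₀, ∀ N ≥ N₀, ∀ (l r : List S) (g : Bool → S),
    l.length + r.length + 1 ≤ 3 * N →
      ∃ (x : Fin (2 * N) → Bool) (v : Fin (2 * N)),
        (Finset.univ.filter fun i => x i = true).card = N ∧
        (T.Accepts (l ++ (List.ofFn (Function.update x v (!(x v)))).map g ++ r) ↔
          T.Accepts (l ++ (List.ofFn x).map g ++ r)) := by
  obtain ⟨N₀, h⟩ := T.exists_flip_activation_eq_of_large
  refine ⟨N₀, fun N hN l r g hlr => ?_⟩
  obtain ⟨x, v, hx, hv⟩ := h N hN (l.length + 2 * N + r.length) (by omega)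
    (fun x i => (l ++ (List.ofFn x).map g ++ r)[(i : ℕ)]?)
    fun i => decisionTree_getElem_append l r g i
  refine ⟨x, v, hx, T.accepts_congr ?_⟩
  rw [T.finalActivation_eq _ (n := l.length + 2 * N + r.length) (by simp; ring),
    T.finalActivation_eq _ (n := l.length + 2 * N + r.length) (by simp; ring)]
  exact hv

end HardAttentionTransformer

/-! ### PARITY -/

section Parity

variable {E P A : Type*}

theorem not_recognizesAtLength_parityLang (T : HardAttentionTransformer Bool E P A) :
    ∃ N : ℕ, ∀ n ≥ N, ¬ T.RecognizesAtLength parityLang n := by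
  obtain ⟨N₀, h⟩ := T.exists_flip_accepts_iff
  refine ⟨2 * N₀ + 2, fun n hn hrec => ?_⟩
  -- For odd `n` one trailing zero fills the length without changing the parity.
  obtain ⟨x, v, hx, hv⟩ := h (n / 2) (by omega) [] (List.replicate (n % 2) false) id
    (by simp; omega)
  rw [hrec _ (by simp; omega), hrec _ (by simp; omega)] at hv
  have hmem : ∀ y : Fin (2 * (n / 2)) → Bool,
      ([] ++ (List.ofFn y).map id ++ List.replicate (n % 2) false) ∈ parityLang ↔
        Even (Finset.univ.filter fun i => y i = true).card := fun y => by
    change Even (List.count true _) ↔ _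
    simp [List.count_append, count_ofFn_eq_card, List.count_replicate]
  rw [hmem, hmem, Nat.even_iff, Nat.even_iff] at hv
  have := card_filter_update_not x v
  omega

end Parity

/-! ### Dyck languages -/

section Dyck

variable {κ : Type*}

/-- Induction on the derivation: the cut lies before the first bracket, inside the wrapped word, or
after the matching closing bracket. -/
theorem WellBracketed.insert_pair (c : κ) {w : List (BracketSymbol κ)} (hw : WellBracketed w) :
    ∀ u v, w = u ++ v → WellBracketed (u ++ .opening c :: .closing c :: v) := by
  induction hw with
  | nil =>
    intro u v h
    obtain ⟨rfl, rfl⟩ := List.append_eq_nil_iff.1 h.symm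
    exact .wrap c [] [] .nil .nil
  | wrap d s t hs ht ihs iht =>
    intro u v h
    cases u with
    | nil =>
      rw [List.nil_append] at h
      subst h
      exact .wrap c [] _ .nil (.wrap d s t hs ht)
    | cons e u =>
      rw [List.cons_append, List.cons.injEq] at h
      obtain ⟨rfl, h⟩ := h
      rcases List.append_eq_append_iff.1 h with ⟨r, rfl, hr⟩ | ⟨r, rfl, rfl⟩
      · cases r with
        | nil =>
          rw [List.nil_append] at hr
          subst hr
          have := WellBracketed.wrap d _ t (ihs s [] (by simp)) ht
          simpa using this
        | cons e r =>
          rw [List.cons_append, List.cons.injEq] at hr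
          obtain ⟨rfl, rfl⟩ := hr
          have := WellBracketed.wrap d s _ hs (iht r v rfl)
          simpa using this
      · have := WellBracketed.wrap d _ t (ihs u r rfl) ht
        simpa using this

theorem WellBracketed.count_eq {w : List (BracketSymbol κ)} (hw : WellBracketed w)
    (f : BracketSymbol κ → ℤ) (hf : ∀ c, f (.opening c) + f (.closing c) = 0) :
    (w.map f).sum = 0 := by
  induction hw with
  | nil => simp
  | wrap c u v _ _ hu hv =>
    have := hf c
    simp only [List.map_cons, List.map_append, List.sum_cons, List.sum_append, hu, hv]
    linarith

/-- The bracket of type `c` encoding a bit. -/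
def bracketOfBool (c : κ) (b : Bool) : BracketSymbol κ := if b then .opening c else .closing c

/-- The `a` initial brackets outnumber or equal all closings in `z`, so the height never becomes
negative. In the induction a leading opening bracket joins the initial block, and a leading closing
bracket forms with the last initial one an inserted pair. -/
theorem wellBracketed_of_count (c : κ) (z : List Bool) : ∀ a b : ℕ,
    a + z.count true = b + z.count false → z.count false ≤ a →
    WellBracketed (List.replicate a (.opening c) ++ z.map (bracketOfBool c) ++
      List.replicate b (.closing c)) := by
  induction z with
  | nil =>
    intro a b hab _
    obtain rfl : a = b := by simpa using hab
    clear hab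
    induction a with
    | zero => exact .nil
    | succ a ih =>
      have := WellBracketed.wrap c _ [] (ih (by simp)) .nil
      rw [List.replicate_succ' (a := BracketSymbol.closing c)]
      simpa [List.replicate_succ] using this
  | cons d z ih =>
    intro a b hab ha
    cases d
    · simp only [List.count_cons_self, ne_eq, Bool.false_eq_true, not_false_eq_true,
        List.count_cons_of_ne] at hab ha
      obtain ⟨a, rfl⟩ : ∃ a', a = a' + 1 := ⟨a - 1, by omega⟩
      have := (ih a b (by omega) (by omega)).insert_pair c (List.replicate a (.opening c))
        (z.map (bracketOfBool c) ++ List.replicate b (.closing c)) (by simp)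
      simpa [List.replicate_succ', bracketOfBool] using this
    · simp only [List.count_cons_self, ne_eq, Bool.true_eq_false, not_false_eq_true,
        List.count_cons_of_ne] at hab ha
      have := ih (a + 1) b (by omega) (by omega)
      simpa [List.replicate_succ', bracketOfBool] using this

theorem sum_map_bracketOfBool (c : κ) (f : BracketSymbol κ → ℤ) (hop : f (.opening c) = 1)
    (hcl : f (.closing c) = -1) (z : List Bool) :
    ((z.map (bracketOfBool c)).map f).sum = z.count true - z.count false := by
  induction z with
  | nil => simp
  | cons d z ih =>
    rw [List.map_cons, List.map_cons, List.sum_cons, ih]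
    cases d <;> simp [bracketOfBool, hop, hcl] <;> ring

theorem count_eq_of_wellBracketed (c : κ) (z : List Bool) (a : ℕ)
    (h : WellBracketed (List.replicate a (.opening c) ++ z.map (bracketOfBool c) ++
      List.replicate a (.closing c))) : z.count true = z.count false := by
  let f : BracketSymbol κ → ℤ := fun s => match s with
    | .opening _ => 1
    | .closing _ => -1
  have h1 := h.count_eq f fun _ => rfl
  rw [List.map_append, List.map_append, List.sum_append, List.sum_append,
    sum_map_bracketOfBool c f rfl rfl] at h1
  simp [f] at h1
  omega

theorem not_recognizesAtLength_dyckLang {E P A : Type*} {k : ℕ} (c : Fin k)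
    (T : HardAttentionTransformer (BracketSymbol (Fin k)) E P A) :
    ∃ N : ℕ, ∀ n ≥ N, Even n → ¬ T.RecognizesAtLength (dyckLang k) n := by
  obtain ⟨N₀, h⟩ := T.exists_flip_accepts_iff
  -- With `n = 2 * m` and `N = m / 2`, each padding block has `m - N ≥ N` brackets, enough for the
  -- `N` closings of a balanced string. The summand `12` gives `N ≥ 3`, hence `2 * (m - N) + 1 ≤ 3 *
  -- N`.
  refine ⟨4 * N₀ + 12, fun n hn heven hrec => ?_⟩
  obtain ⟨m, rfl⟩ := heven
  obtain ⟨N, hN⟩ : ∃ N, N = m / 2 := ⟨_, rfl⟩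
  obtain ⟨x, v, hx, hv⟩ := h N (by omega) (List.replicate (m - N) (.opening c))
    (List.replicate (m - N) (.closing c)) (bracketOfBool c) (by simp; omega)
  rw [hrec _ (by simp; omega), hrec _ (by simp; omega)] at hv
  have hcount : ∀ y : Fin (2 * N) → Bool,
      (List.ofFn y).count true + (List.ofFn y).count false = 2 * N := fun y => by
    rw [List.count_true_add_count_false, List.length_ofFn]
  have hcx := hcount x
  have hcy := hcount (Function.update x v (!(x v)))
  have hmem : WellBracketed (List.replicate (m - N) (.opening c) ++
      (List.ofFn x).map (bracketOfBool c) ++ List.replicate (m - N) (.closing c)) := by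
    refine wellBracketed_of_count c _ _ _ ?_ ?_
    · rw [count_ofFn_eq_card x true] at hcx ⊢
      omega
    · rw [count_ofFn_eq_card x true] at hcx
      omega
  have hflip := count_eq_of_wellBracketed c _ _ (hv.2 hmem)
  have := card_filter_update_not x v
  rw [← count_ofFn_eq_card, ← count_ofFn_eq_card] at this
  rw [← count_ofFn_eq_card] at hx
  omega

end Dyck

theorem mainTheorem2 {E P A : Type*} :
    (∀ T : HardAttentionTransformer Bool E P A,
      ∃ N : ℕ, ∀ n ≥ N, ¬ T.RecognizesAtLength parityLang n) ∧
    (∀ T : HardAttentionTransformer (BracketSymbol (Fin 2)) E P A,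
      ∃ N : ℕ, ∀ n ≥ N, Even n → ¬ T.RecognizesAtLength (dyckLang 2) n) ∧
    (∀ T : HardAttentionTransformer (BracketSymbol (Fin 1)) E P A,
      ∃ N : ℕ, ∀ n ≥ N, Even n → ¬ T.RecognizesAtLength (dyckLang 1) n) :=
  ⟨not_recognizesAtLength_parityLang, not_recognizesAtLength_dyckLang 0,
    not_recognizesAtLength_dyckLang 0⟩
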